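/- Let $K$ be an algebraically closed field of characteristic $2$, let $\alpha\in K$ be a root of $t^{14}+t^{13}+t^{11}+t^{10}+t^{8}+t^{6}+t^{4}+t+1$ and $\beta\in K$ a root of $t^{5}+t^{3}+t^{2}+t+1$. In $\mathbb{P}^2(K)$ let $P=(0:0:1)$, let $Q_1,\dots,Q_{14}$ be the images of $Q=(\alpha^{11898}:\alpha^{137}:1)$ under the Frobenius iterates $(x:y:z)\mapsto(x^{2^i}:y^{2^i}:z^{2^i})$, $0\le i<14$, and let $R_1,\dots,R_5$ be the images of $R=(\beta^{6}:\beta^{15}:1)$ under the Frobenius iterates with $0\le i<5$. Let $k$ be any subfield of $K$ (for instance $\mathbb{F}_2$ or $K$ itself). For $d\ge 0$ let $V_d\subset k[x,y,z]_d$ be the $k$-vector space of forms of degree $d$ that have multiplicity at least $3$ at $P$, at least $2$ at each $Q_i$ and at least $1$ at each $R_j$, where $F$ has multiplicity at least $m$ at a point $p$ if it lies in $I_p^m$, with $I_p\subset K[x,y,z]$ the homogeneous ideal of $p$. Then the twenty points $P,Q_1,\dots,Q_{14},R_1,\dots,R_5$ are pairwise distinct, and the linear system of nonics $$|9L-3P-2Q_1-\dots-2Q_{14}-R_1-\dots-R_5|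 = \mathbb{P}(V_9)$$ ($L$ the class of a line) is a $\mathbb{P}^4$, i.e. $\dim_k V_9=5$. Moreover it has only the assigned base points: 1. the set of common zeros in $\mathbb{P}^2(K)$ of the forms in $V_9$ is $\{P,Q_1,\dots,Q_{14},R_1,\dots,R_5\}$; 2. the base scheme, defined by the ideal $I=(V_9)\subset k[x,y,z]$, is zero-dimensional of degree $1\cdot 6+14\cdot 3+5\cdot 1=53$, i.e. $\dim_k(k[x,y,z]/I)_d=53$ for all sufficiently large $d$; 3. the base scheme is the union of the assigned fat points $3P$, $2Q_i$, $R_j$, i.e. $V_d\subset I$ for all sufficiently large $d$. -/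

import Mathlib

open MvPolynomial LinearAlgebra.Projectivization

noncomputable section

namespace PlaneSystem

/-- The projective plane `ℙ²(K)`. -/
abbrev Plane (K : Type*) [Field K] : Type _ := ℙ K (Fin 3 → K)

/-- The point `(x : y : 1)`. -/
def affinePoint {K : Type*} [Field K] (x y : K) : Plane K :=
  Projectivization.mk K ![x, y, 1] (fun h => one_ne_zero (congrFun h 2))

/-- The `i`-th iterate of the `2`-Frobenius `(x : y : z) ↦ (x² : y² : z²)` applied to
`(x : y : 1)`. -/
def frobeniusPoint {K : Type*} [Field K] (x y : K) (i : ℕ) : Plane K :=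
  affinePoint (x ^ 2 ^ i) (y ^ 2 ^ i)

/-- A form over the subfield `k` vanishes at a point of the plane over `K`. -/
def VanishesAt {k K : Type*} [Field k] [Field K] [Algebra k K]
    (F : MvPolynomial (Fin 3) k) (p : Plane K) : Prop :=
  ∀ v ∈ p.submodule, aeval v F = 0

/-- The homogeneous ideal of a point, generated by the linear forms vanishing there. -/
def pointIdeal {K : Type*} [Field K] (p : Plane K) : Ideal (MvPolynomial (Fin 3) K) :=
  Ideal.span {l | l.IsHomogeneous 1 ∧ VanishesAt l p}

/-- The forms of degree `d` with coefficients in `k` which have, for every `i`, multiplicity at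
least `m i` at the `K`-rational point `p i`, i.e. whose image over `K` lies in the `m i`-th power
of the ideal of `p i`. -/
def linearSystem (k : Type*) {K : Type*} [Field k] [Field K] [Algebra k K] {ι : Type*}
    (d : ℕ) (p : ι → Plane K) (m : ι → ℕ) : Submodule k (MvPolynomial (Fin 3) k) where
  carrier := {F | F.IsHomogeneous d ∧ ∀ i, map (algebraMap k K) F ∈ pointIdeal (p i) ^ m i}
  zero_mem' := ⟨isHomogeneous_zero _ _ _, fun i => by simp⟩
  add_mem' := fun hF hG =>
    ⟨hF.1.add hG.1, fun i => by rw [map_add]; exact Ideal.add_mem _ (hF.2 i) (hG.2 i)⟩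
  smul_mem' := fun c F hF =>
    ⟨(homogeneousSubmodule (Fin 3) k d).smul_mem c hF.1, fun i => by
      rw [smul_eq_C_mul, map_mul]; exact Ideal.mul_mem_left _ _ (hF.2 i)⟩

/-- The ideal of `k[x, y, z]` generated by a linear system; it defines its base scheme. -/
def baseIdeal {k : Type*} [Field k] (V : Submodule k (MvPolynomial (Fin 3) k)) :
    Ideal (MvPolynomial (Fin 3) k) :=
  Ideal.span (V : Set (MvPolynomial (Fin 3) k))

/-- The set of `K`-rational base points of a linear system over `k`. -/
def basePoints {k : Type*} (K : Type*) [Field k] [Field K] [Algebra k K]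
    (V : Submodule k (MvPolynomial (Fin 3) k)) : Set (Plane K) :=
  {p | ∀ F ∈ V, VanishesAt F p}

/-- The Hilbert function `d ↦ dim_k (k[x, y, z] / I)_d`. -/
def hilbertFunction {k : Type*} [Field k] (I : Ideal (MvPolynomial (Fin 3) k)) (d : ℕ) : ℕ :=
  Module.finrank k (homogeneousSubmodule (Fin 3) k d ⧸
    (I.restrictScalars k).submoduleOf (homogeneousSubmodule (Fin 3) k d))

/-- The homogeneous ideal `I` defines a subscheme of the plane of dimension at most `0` and of
degree `n`: its Hilbert polynomial is the constant `n`. -/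
def HasDegree {k : Type*} [Field k] (I : Ideal (MvPolynomial (Fin 3) k)) (n : ℕ) : Prop :=
  ∀ᶠ d in Filter.atTop, hilbertFunction I d = n

/-- The twenty assigned points: `P = (0 : 0 : 1)`, the Frobenius orbit of
`Q = (a ^ 11898 : a ^ 137 : 1)` and the Frobenius orbit of `R = (b ^ 6 : b ^ 15 : 1)`. -/
def assignedPoint {K : Type*} [Field K] (a b : K) : Unit ⊕ Fin 14 ⊕ Fin 5 → Plane K :=
  Sum.elim (fun _ => affinePoint 0 0)
    (Sum.elim (fun i => frobeniusPoint (a ^ 11898) (a ^ 137) i)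
      (fun i => frobeniusPoint (b ^ 6) (b ^ 15) i))

/-- The assigned multiplicities: `3` at `P`, `2` at the `Q_i` and `1` at the `R_i`. -/
def assignedMult : Unit ⊕ Fin 14 ⊕ Fin 5 → ℕ :=
  Sum.elim (fun _ => 3) (Sum.elim (fun _ => 2) (fun _ => 1))

end PlaneSystem

end

/-! ### Polynomials over the field with two elements as natural numbers -/

namespace PlaneSystem

/-! The fat points have total degree 6 + 14·3 + 5 = 53, and two opposite bounds meet at this number.
From below: all the points lie in the chart z = 1, and Taylor coefficients together with the Chinese
remainder theorem map K[x, y] onto a space of dimension 53 in which the ideal of the fat points goes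
to zero (`pi_jet_surjective`). From above: five explicit nonics over 𝔽₂ lie in the system
(`form_nonic_mem_linearSystem`), and modulo the ideal they generate every form of degree at least 12
is a combination of 53 standard monomials (`mem_monomialSpan`).

The ideal of the nonics is contained in that of the fat points. Hence 53 monomials which span modulo
the smaller ideal are independent modulo the larger one (`eq_zero_of_sum_mem_assignedIdeal`). A form
with the assigned multiplicities therefore has zero standard part and lies in the ideal of the
nonics. This gives the Hilbert function and the base scheme in degrees d ≥ 12; in degree 9 the same
argument, with the standard monomials of degree at most 9, shows that the nonics span the system. A
base point is not at infinity, since x^12 and y^12 lie in (z) modulo the nonics; a base point in the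
chart is a zero of the whole ideal of the fat points, hence one of them.

The explicit identities have coefficients in 𝔽₂, so they hold over every k. They are encoded in
binary digits and checked by evaluation in the kernel. -/

/-- The positions of the binary digits `1` of `n`. -/
def bitList (n : ℕ) : List ℕ := (List.range (n.log2 + 1)).filter n.testBit

/-- The sum of `v i` over the positions `i` of the binary digits `1` of `n`. -/
def bitSum {M : Type*} [AddCommMonoid M] (v : ℕ → M) (n : ℕ) : M := ((bitList n).map v).sum

/-- The sum in `𝔽₂[t]` of a list of polynomials, encoded by their binary digits. -/
def xorSum (l : List ℕ) : ℕ := l.foldr (· ^^^ ·) 0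

/-- Multiplication in `𝔽₂[t]`, with polynomials encoded by their binary digits. -/
def bitMul (m n : ℕ) : ℕ := xorSum ((bitList m).map (n <<< ·))

/-- Reduction in `𝔽₂[t]` of `n` modulo the polynomial `f` of degree `r`. -/
def bitMod (f r n : ℕ) : ℕ :=
  (List.range (n.log2 + 1 - r)).foldr (fun i m => if m.testBit (r + i) then m ^^^ f <<< i else m) n

/-- The power `t ^ e` in `𝔽₂[t]` modulo the polynomial `f` of degree `r`, for `e < 2 ^ s`. -/
def bitPow (f r : ℕ) : ℕ → ℕ → ℕ
  | 0, _ => 1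
  | s + 1, e => bitMod f r (bitMul (if e.testBit 0 then 2 else 1)
      (bitMod f r (bitMul (bitPow f r s (e / 2)) (bitPow f r s (e / 2)))))

theorem mem_bitList {n i : ℕ} : i ∈ bitList n ↔ n.testBit i = true := by
  simp only [bitList, List.mem_filter, List.mem_range, and_iff_right_iff_imp]
  intro h
  by_contra hi
  have := Nat.testBit_lt_two_pow (n.lt_log2_self.trans_le
    (Nat.pow_le_pow_right two_pos (not_lt.mp hi)))
  simp_all

section Sums

variable {M : Type*} [AddCommMonoid M]

/-- The freedom in `N` is the point: two numbers of different lengths can be compared over one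
common range. -/
theorem bitSum_eq_sum (v : ℕ → M) {n N : ℕ} (h : n < 2 ^ N) :
    bitSum v n = ∑ i ∈ Finset.range N, if n.testBit i then v i else 0 := by
  have key : bitSum v n = ∑ i ∈ Finset.range (n.log2 + 1), if n.testBit i then v i else 0 := by
    rw [← Finset.sum_filter, Finset.sum_eq_multiset_sum]
    simp [bitSum, bitList, Multiset.range]
  rw [key]
  have aux : ∀ a b : ℕ, n < 2 ^ a → a ≤ b →
      (∑ i ∈ Finset.range a, if n.testBit i then v i else 0) =
        ∑ i ∈ Finset.range b, if n.testBit i then v i else 0 := by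
    intro a b ha hab
    refine Finset.sum_subset (Finset.range_mono hab) fun i _ hi => ?_
    rw [Nat.testBit_lt_two_pow (ha.trans_le (Nat.pow_le_pow_right two_pos (by simpa using hi)))]
    rfl
  rcases le_total (n.log2 + 1) N with hN | hN
  · exact aux _ _ n.lt_log2_self hN
  · exact (aux _ _ h hN).symm

theorem bitSum_congr {v w : ℕ → M} {n : ℕ} (h : ∀ i, n.testBit i = true → v i = w i) :
    bitSum v n = bitSum w n := by
  rw [bitSum, bitSum, List.map_congr_left fun i hi => h i (mem_bitList.mp hi)]

theorem bitSum_zero (v : ℕ → M) : bitSum v 0 = 0 := by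
  simpa using bitSum_eq_sum v (n := 0) (N := 0) (by simp)

theorem bitSum_two_pow (v : ℕ → M) (i : ℕ) : bitSum v (2 ^ i) = v i := by
  rw [bitSum_eq_sum v (Nat.pow_lt_pow_right one_lt_two i.lt_succ_self)]
  simp [Nat.testBit_two_pow]

theorem bitSum_shiftLeft (v : ℕ → M) (n s : ℕ) :
    bitSum v (n <<< s) = bitSum (fun i => v (s + i)) n := by
  have h : n <<< s < 2 ^ (s + n) := by
    rw [Nat.shiftLeft_eq, pow_add, mul_comm]
    exact Nat.mul_lt_mul_of_pos_left n.lt_two_pow_self (by positivity)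
  rw [bitSum_eq_sum v h, bitSum_eq_sum _ n.lt_two_pow_self, Finset.sum_range_add,
    Finset.sum_eq_zero, zero_add]
  · simp
  · intro i hi
    simp [Nat.testBit_shiftLeft, Finset.mem_range.mp hi]

theorem map_bitSum {N F : Type*} [AddCommMonoid N] [FunLike F M N] [AddMonoidHomClass F M N]
    (f : F) (v : ℕ → M) (n : ℕ) : f (bitSum v n) = bitSum (fun i => f (v i)) n := by
  rw [bitSum, bitSum, map_list_sum, List.map_map]
  rfl

theorem bitSum_mem {S : Type*} [SetLike S M] [AddSubmonoidClass S M] {s : S} {v : ℕ → M} {n : ℕ}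
    (h : ∀ i, n.testBit i = true → v i ∈ s) : bitSum v n ∈ s := by
  refine list_sum_mem fun x hx => ?_
  obtain ⟨i, hi, rfl⟩ := List.mem_map.mp hx
  exact h i (mem_bitList.mp hi)

end Sums

/-! ### Binary arithmetic in characteristic two -/

section CharTwo

variable {R : Type*} [CommRing R] [CharP R 2]

theorem bitSum_xor (v : ℕ → R) (m n : ℕ) :
    bitSum v (m ^^^ n) = bitSum v m + bitSum v n := by
  have hm : m < 2 ^ (m + n) :=
    m.lt_two_pow_self.trans_le (Nat.pow_le_pow_right two_pos (Nat.le_add_right _ _))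
  have hn : n < 2 ^ (m + n) :=
    n.lt_two_pow_self.trans_le (Nat.pow_le_pow_right two_pos (Nat.le_add_left _ _))
  rw [bitSum_eq_sum v hm, bitSum_eq_sum v hn, bitSum_eq_sum v (Nat.xor_lt_two_pow hm hn),
    ← Finset.sum_add_distrib]
  refine Finset.sum_congr rfl fun i _ => ?_
  rw [Nat.testBit_xor]
  cases m.testBit i <;> cases n.testBit i <;> simp [CharTwo.add_self_eq_zero]

theorem bitSum_xorSum (v : ℕ → R) (l : List ℕ) :
    bitSum v (xorSum l) = (l.map (bitSum v)).sum := by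
  induction l with
  | nil => simp [xorSum, bitSum_zero]
  | cons n l ih => simpa [xorSum, bitSum_xor] using ih

theorem mul_bitSum {R : Type*} [CommRing R] (c : R) (v : ℕ → R) (n : ℕ) :
    c * bitSum v n = bitSum (fun i => c * v i) n :=
  map_bitSum (AddMonoidHom.mulLeft c) v n

/-- The product of encoded polynomials is computed by `bitMul` as soon as the encoding of monomials
is multiplicative on the monomials which occur. -/
theorem bitSum_bitMul {u v w : ℕ → R} {m n : ℕ}
    (h : ∀ s i, m.testBit s = true → n.testBit i = true → w (s + i) = u s * v i) :
    bitSum w (bitMul m n) = bitSum u m * bitSum v n := by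
  rw [bitMul, bitSum_xorSum, List.map_map, bitSum, ← List.sum_map_mul_right]
  refine congrArg List.sum (List.map_congr_left fun s hs => ?_)
  rw [Function.comp_apply, bitSum_shiftLeft, ← smul_eq_mul,
    bitSum_congr fun i hi => h s i (mem_bitList.mp hs) hi]
  exact (mul_bitSum (u s) v n).symm

variable {a : R} {f : ℕ}

theorem bitSum_pow_bitMul (a : R) (m n : ℕ) :
    bitSum (a ^ ·) (bitMul m n) = bitSum (a ^ ·) m * bitSum (a ^ ·) n :=
  bitSum_bitMul fun s i _ _ => pow_add a s i

/-- Each step of the long division adds a multiple of `f`, which vanishes at `a`. That the result is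
really reduced, or that `f` has degree `r`, plays no role. -/
theorem bitSum_pow_bitMod (hf : bitSum (a ^ ·) f = 0) (r n : ℕ) :
    bitSum (a ^ ·) (bitMod f r n) = bitSum (a ^ ·) n := by
  unfold bitMod
  induction List.range (n.log2 + 1 - r) with
  | nil => rfl
  | cons i l ih =>
    rw [List.foldr_cons]
    split_ifs
    · rw [bitSum_xor, ih, bitSum_shiftLeft]
      simp only [pow_add, ← mul_bitSum, hf, mul_zero, add_zero]
    · exact ih

theorem bitSum_pow_bitPow (hf : bitSum (a ^ ·) f = 0) (r : ℕ) {s e : ℕ} (he : e < 2 ^ s) :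
    bitSum (a ^ ·) (bitPow f r s e) = a ^ e := by
  induction s generalizing e with
  | zero =>
    obtain rfl : e = 0 := by simpa using he
    simpa [bitPow] using bitSum_two_pow (a ^ ·) 0
  | succ s ih =>
    have h1 : bitSum (a ^ ·) (if e.testBit 0 then 2 else 1) = a ^ (e % 2) := by
      rcases Nat.mod_two_eq_zero_or_one e with h | h
      · simpa [Nat.testBit_zero, h] using bitSum_two_pow (a ^ ·) 0
      · simpa [Nat.testBit_zero, h] using bitSum_two_pow (a ^ ·) 1
    rw [bitPow, bitSum_pow_bitMod hf, bitSum_pow_bitMul, bitSum_pow_bitMod hf, bitSum_pow_bitMul,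
      ih (by omega), h1, ← pow_add, ← pow_add]
    congr 1
    omega

end CharTwo

end PlaneSystem

/-! ### Forms over the field with two elements as natural numbers -/

noncomputable section

namespace PlaneSystem

/-- The monomial `x ^ i * y ^ j * z ^ (d - i - j)`, encoded by `i + 16 * j`. -/
def formMonomial (k : Type*) [Field k] (d p : ℕ) : MvPolynomial (Fin 3) k :=
  X 0 ^ (p % 16) * X 1 ^ (p / 16) * X 2 ^ (d - (p % 16 + p / 16))

/-- The form of degree `d` over `𝔽₂` whose monomials are given by the binary digits of `n`. -/
def form (k : Type*) [Field k] (d n : ℕ) : MvPolynomial (Fin 3) k := bitSum (formMonomial k d) n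

/-- All monomials encoded in `n` have degree at most `d` in `x` and `y`. -/
def BitDegreeLE (n d : ℕ) : Prop := ∀ p ∈ bitList n, p % 16 + p / 16 ≤ d

instance (n d : ℕ) : Decidable (BitDegreeLE n d) :=
  inferInstanceAs (Decidable (∀ p ∈ bitList n, _))

/-- The span of the monomials of degree `d` encoded by the binary digits of `B`. -/
def monomialSpan (k : Type*) [Field k] (d B : ℕ) : Submodule k (MvPolynomial (Fin 3) k) :=
  Submodule.span k (formMonomial k d '' {p | B.testBit p = true})

/-- Five nonics which generate the linear system. -/
def nonics : List ℕ :=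
  [340287559613949900471022339796728808064,
    5192534559947774644746149048091000,
    25961801234338949844065343559696648,
    680564734158823427607737116746318611344,
    22300745208916326075850329841543368256520192]

/-- For each nonic, a monomial which occurs in no other one. -/
def nonicLeads : List ℕ := [39, 54, 114, 129, 144]

/-- A set of `53` monomials which is a basis modulo the ideal generated by the nonics. -/
def standardBits : ℕ := 340297945000012669149023594574684030975

/-- The standard monomials of degree at most `9` in `x` and `y`. -/
def standardBitsNine : ℕ := 340297944999973983522795926441059877887

/-- For each non-standard monomial of degree `12`, the coefficients of a combination of the nonics
which differs from that monomial by standard monomials only. -/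
def cofactors : List (ℕ × List ℕ) :=
  [(39, [1, 0, 0, 0, 0]), (54, [0, 1, 0, 0, 0]), (114, [0, 0, 1, 0, 0]), (129, [0, 0, 0, 1, 0]),
   (144, [65537, 3, 1, 0, 0]), (40, [3, 1, 0, 1, 0]), (55, [0, 2, 0, 0, 0]),
   (70, [2, 65537, 0, 1, 0]), (100, [0, 65537, 65537, 2, 0]), (115, [1, 1, 2, 0, 0]),
   (130, [3, 65537, 0, 3, 0]), (145, [131074, 65542, 65538, 2, 0]),
   (160, [4295032835, 131073, 2, 2, 0]), (11, [262150, 4295163916, 4295163904, 4, 0]),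
   (26, [4295426061, 131076, 281483566645255, 8590196746, 0]),
   (41, [262144, 4295098382, 4295098368, 5, 0]),
   (56, [4295426062, 196608, 281483566645254, 8590196747, 0]),
   (71, [262147, 4295032847, 4295163904, 7, 0]),
   (86, [4295360525, 4295098368, 281483566710789, 8590196745, 0]),
   (101, [4295098377, 196623, 281487861678087, 8590196746, 0]),
   (116, [65537, 4294967302, 6, 1, 0]),
   (131, [4295360522, 4295032834, 281483566645252, 8590196749, 0]),
   (146, [4295426061, 4295098372, 281487861678082, 8590196747, 0]),
   (161, [12885229578, 458758, 281483566710786, 8590196749, 0]),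
   (176, [281479271809028, 12885032960, 4295032838, 7, 0]),
   (12, [327680, 8590262281, 12885229579, 262157, 0]),
   (27, [131079, 281483566841862, 281487862071298, 8590196740, 0]),
   (42, [4295426055, 8590393345, 281474976972814, 8589934592, 0]),
   (57, [196610, 281487861678090, 281487862071299, 8590196742, 0]),
   (72, [14, 8590131206, 8590393353, 262156, 0]),
   (87, [65543, 281479271874571, 281487861874692, 8590196736, 0]),
   (102, [4295360522, 281487861809161, 12885164047, 262156, 0]),
   (117, [4295229452, 12885098508, 281483566710792, 8590196747, 0]),
   (132, [9, 281474977038346, 281487862071300, 8590196746, 0]),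
   (147, [393216, 281479271743499, 281474977169416, 8590196736, 0]),
   (162, [131081, 281483566907394, 281487861612553, 262153, 0]),
   (177, [4295426050, 4295229449, 281487861612554, 281483566907395, 0]),
   (192, [12884901899, 12884967426, 281483566972931, 8589934605, 281474976710656])]

/-! ### Numerical certificates for division by the nonics -/

section Certificates

theorem bitDegreeLE_nonics : ∀ n ∈ nonics, BitDegreeLE n 9 := by decide +kernel

theorem bitDegreeLE_standardBits : BitDegreeLE standardBits 10 := by decide +kernel

theorem length_bitList_standardBits : (bitList standardBits).length = 53 := by decide +kernel

theorem standardBitsNine_le :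
    ∀ p ∈ bitList standardBitsNine, standardBits.testBit p = true := by decide +kernel

theorem bitDegreeLE_cofactors : ∀ c ∈ cofactors, ∀ h ∈ c.2, BitDegreeLE h 3 := by decide +kernel

theorem cofactors_spec : ∀ c ∈ cofactors,
    ∀ p ∈ bitList (xorSum (List.zipWith bitMul c.2 nonics) ^^^ 2 ^ c.1),
      standardBits.testBit p = true := by decide +kernel

theorem standardBits_or_cofactors : ∀ p ∈ List.range 256, p % 16 + p / 16 ≤ 12 →
    standardBits.testBit p = true ∨ p ∈ cofactors.map Prod.fst := by decide +kernel

theorem nonicLeads_spec : ∀ c ∈ List.zip nonicLeads nonics,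
    ∀ p ∈ bitList (c.2 ^^^ 2 ^ c.1), standardBitsNine.testBit p = true := by decide +kernel

theorem standardBitsNine_or_nonicLeads : ∀ p ∈ List.range 256, p % 16 + p / 16 ≤ 9 →
    standardBitsNine.testBit p = true ∨ p ∈ (List.zip nonicLeads nonics).map Prod.fst := by
  decide +kernel

end Certificates

variable {k : Type*} [Field k]

theorem BitDegreeLE.le {n d p : ℕ} (h : BitDegreeLE n d) (hp : n.testBit p = true) :
    p % 16 + p / 16 ≤ d :=
  h p (mem_bitList.mpr hp)

theorem isHomogeneous_formMonomial {d p : ℕ} (h : p % 16 + p / 16 ≤ d) :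
    (formMonomial k d p).IsHomogeneous d := by
  have := (((isHomogeneous_X k (0 : Fin 3)).pow (p % 16)).mul
    ((isHomogeneous_X k (1 : Fin 3)).pow (p / 16))).mul
    ((isHomogeneous_X k (2 : Fin 3)).pow (d - (p % 16 + p / 16)))
  rwa [one_mul, one_mul, one_mul, Nat.add_sub_cancel' h] at this

theorem isHomogeneous_form {d n : ℕ} (h : BitDegreeLE n d) : (form k d n).IsHomogeneous d :=
  bitSum_mem (s := homogeneousSubmodule (Fin 3) k d)
    fun _ hp => isHomogeneous_formMonomial (h.le hp)

theorem formMonomial_succ {d p : ℕ} (h : p % 16 + p / 16 ≤ d) :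
    formMonomial k (d + 1) p = X 2 * formMonomial k d p := by
  rw [formMonomial, formMonomial, Nat.sub_add_comm h, pow_succ]
  ring

/-- Total degree below 16 prevents a carry from the exponent of x into that of y, so adding codes
multiplies monomials. -/
theorem formMonomial_add {d e s p : ℕ} (hs : s % 16 + s / 16 ≤ d) (hp : p % 16 + p / 16 ≤ e)
    (hde : d + e < 16) :
    formMonomial k (d + e) (s + p) = formMonomial k d s * formMonomial k e p := by
  have h1 : (s + p) % 16 = s % 16 + p % 16 := by omega
  have h2 : (s + p) / 16 = s / 16 + p / 16 := by omega
  have h3 : d + e - (s % 16 + p % 16 + (s / 16 + p / 16)) =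
      d - (s % 16 + s / 16) + (e - (p % 16 + p / 16)) := by omega
  rw [formMonomial, formMonomial, formMonomial, h1, h2, h3, pow_add, pow_add, pow_add]
  ring

theorem form_mem_monomialSpan {d n B : ℕ} (h : ∀ p ∈ bitList n, B.testBit p = true) :
    form k d n ∈ monomialSpan k d B :=
  bitSum_mem fun p hp => Submodule.subset_span ⟨p, h p (mem_bitList.mpr hp), rfl⟩

/-- A subspace which contains all monomials of degree `d` contains all forms of degree `d`. -/
theorem mem_of_monomials {d : ℕ} {N : Submodule k (MvPolynomial (Fin 3) k)}
    (h : ∀ i j, i + j ≤ d → X 0 ^ i * X 1 ^ j * X 2 ^ (d - (i + j)) ∈ N)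
    {F : MvPolynomial (Fin 3) k} (hF : F.IsHomogeneous d) : F ∈ N := by
  rw [F.as_sum]
  refine sum_mem fun e he => ?_
  have hd : e 0 + e 1 + e 2 = d := by
    rw [← hF (mem_support_iff.mp he), Finsupp.weight_apply, Finsupp.sum_fintype _ _ (by simp)]
    simp [Fin.sum_univ_three]
  have := N.smul_mem (coeff e F) (h (e 0) (e 1) (by omega))
  rwa [show d - (e 0 + e 1) = e 2 by omega, ← Fin.prod_univ_three fun i => X i ^ e i,
    ← Finsupp.prod_fintype (f := e) (g := fun i n => X (R := k) i ^ n) (by simp), smul_eq_C_mul,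
    ← monomial_eq] at this

theorem formMonomial_encode {d i j : ℕ} (hi : i < 16) :
    formMonomial k d (i + 16 * j) = X 0 ^ i * X 1 ^ j * X 2 ^ (d - (i + j)) := by
  rw [formMonomial, show (i + 16 * j) % 16 = i by omega, show (i + 16 * j) / 16 = j by omega]

theorem mem_of_formMonomial {d : ℕ} (hd : d < 16)
    {N : Submodule k (MvPolynomial (Fin 3) k)}
    (h : ∀ p ∈ List.range 256, p % 16 + p / 16 ≤ d → formMonomial k d p ∈ N)
    {F : MvPolynomial (Fin 3) k} (hF : F.IsHomogeneous d) : F ∈ N :=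
  mem_of_monomials (fun i j hij => by
    rw [← formMonomial_encode (by omega)]
    exact h _ (by rw [List.mem_range]; omega) (by omega)) hF

theorem X_two_mul_mem_monomialSpan {d B : ℕ} (hB : BitDegreeLE B d)
    {F : MvPolynomial (Fin 3) k} (hF : F ∈ monomialSpan k d B) :
    X 2 * F ∈ monomialSpan k (d + 1) B := by
  induction hF using Submodule.span_induction with
  | mem F hF =>
    obtain ⟨p, hp, rfl⟩ := hF
    rw [← formMonomial_succ (hB.le hp)]
    exact Submodule.subset_span ⟨p, hp, rfl⟩
  | zero => simp
  | add F G _ _ hF hG => rw [mul_add]; exact add_mem hF hG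
  | smul c F _ hF => rw [mul_smul_comm]; exact Submodule.smul_mem _ c hF

/-- Monomials of degree `d + 1` with degree at most `d` in x and y all contain the factor z. -/
theorem exists_X_two_mul_of_mem_monomialSpan {d B : ℕ} (hB : BitDegreeLE B d)
    {F : MvPolynomial (Fin 3) k} (hF : F ∈ monomialSpan k (d + 1) B) :
    ∃ G : MvPolynomial (Fin 3) k, G.IsHomogeneous d ∧ F = X 2 * G := by
  induction hF using Submodule.span_induction with
  | mem F hF =>
    obtain ⟨p, hp, rfl⟩ := hF
    exact ⟨_, isHomogeneous_formMonomial (hB.le hp), formMonomial_succ (hB.le hp)⟩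
  | zero => exact ⟨0, isHomogeneous_zero _ _ _, by simp⟩
  | add F G _ _ hF hG =>
    obtain ⟨F', hF, rfl⟩ := hF
    obtain ⟨G', hG, rfl⟩ := hG
    exact ⟨_, hF.add hG, (mul_add _ _ _).symm⟩
  | smul c F _ hF =>
    obtain ⟨F', hF, rfl⟩ := hF
    exact ⟨c • F', (homogeneousSubmodule (Fin 3) k d).smul_mem c hF, (mul_smul_comm _ _ _).symm⟩

theorem form_two_pow (d p : ℕ) : form k d (2 ^ p) = formMonomial k d p :=
  bitSum_two_pow _ p

variable [CharP k 2]

theorem form_xor (d m n : ℕ) : form k d (m ^^^ n) = form k d m + form k d n :=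
  bitSum_xor _ m n

theorem form_bitMul {d e m n : ℕ} (hm : BitDegreeLE m d) (hn : BitDegreeLE n e)
    (hde : d + e < 16) : form k (d + e) (bitMul m n) = form k d m * form k e n :=
  bitSum_bitMul fun _ _ hs hi => formMonomial_add (hm.le hs) (hn.le hi) hde

/-- Modulo the nonics, the forms of degree `9` are spanned by the standard monomials. -/
theorem mem_monomialSpan_nine {N : Submodule k (MvPolynomial (Fin 3) k)}
    (hN : ∀ n ∈ nonics, form k 9 n ∈ N) {F : MvPolynomial (Fin 3) k} (hF : F.IsHomogeneous 9) :
    F ∈ monomialSpan k 9 standardBitsNine ⊔ N := by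
  refine mem_of_formMonomial (by norm_num) (fun p hp hd => ?_) hF
  rcases standardBitsNine_or_nonicLeads p hp hd with h | h
  · exact Submodule.mem_sup_left (Submodule.subset_span ⟨p, h, rfl⟩)
  · obtain ⟨c, hc, rfl⟩ := List.mem_map.mp h
    -- The leading monomial is the nonic plus the remaining terms of the nonic, all of which are
    -- standard.
    rw [← form_two_pow, ← Nat.xor_xor_cancel_left c.2 (2 ^ c.1), form_xor]
    exact add_mem (Submodule.mem_sup_right (hN _ (List.of_mem_zip hc).2))
      (Submodule.mem_sup_left (form_mem_monomialSpan (nonicLeads_spec c hc)))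

variable {I : Ideal (MvPolynomial (Fin 3) k)}

theorem form_xorSum_mem (hI : ∀ n ∈ nonics, form k 9 n ∈ I) {l : List ℕ}
    (hl : ∀ h ∈ l, BitDegreeLE h 3) :
    form k 12 (xorSum (List.zipWith bitMul l nonics)) ∈ I := by
  rw [form, bitSum_xorSum]
  refine list_sum_mem fun F hF => ?_
  obtain ⟨m, hm, rfl⟩ := List.mem_map.mp hF
  rw [← List.map_uncurry_zip_eq_zipWith] at hm
  obtain ⟨c, hc, rfl⟩ := List.mem_map.mp hm
  have := List.of_mem_zip hc
  change form k (3 + 9) (bitMul c.1 c.2) ∈ I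
  rw [form_bitMul (hl _ this.1) (bitDegreeLE_nonics _ this.2) (by norm_num)]
  exact I.mul_mem_left _ (hI _ this.2)

theorem mem_monomialSpan_twelve (hI : ∀ n ∈ nonics, form k 9 n ∈ I)
    {F : MvPolynomial (Fin 3) k} (hF : F.IsHomogeneous 12) :
    F ∈ monomialSpan k 12 standardBits ⊔ I.restrictScalars k := by
  refine mem_of_formMonomial (by norm_num) (fun p hp hd => ?_) hF
  rcases standardBits_or_cofactors p hp hd with h | h
  · exact Submodule.mem_sup_left (Submodule.subset_span ⟨p, h, rfl⟩)
  · obtain ⟨c, hc, rfl⟩ := List.mem_map.mp h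
    rw [← form_two_pow,
      ← Nat.xor_xor_cancel_left (xorSum (List.zipWith bitMul c.2 nonics)) (2 ^ c.1), form_xor]
    exact add_mem (Submodule.mem_sup_right (form_xorSum_mem hI (bitDegreeLE_cofactors c hc)))
      (Submodule.mem_sup_left (form_mem_monomialSpan (cofactors_spec c hc)))

/-- The ideal generated by the nonics has no zeros at infinity. -/
theorem exists_X_two_mul_add_mem (hI : ∀ n ∈ nonics, form k 9 n ∈ I) {d i j : ℕ}
    (hd : 11 ≤ d) (hij : i + j = d + 1) :
    ∃ F G : MvPolynomial (Fin 3) k, F.IsHomogeneous d ∧ G ∈ I ∧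
      X 0 ^ i * X 1 ^ j = X 2 * F + G := by
  induction d, hd using Nat.le_induction generalizing i j with
  | base =>
    have h : (X 0 ^ i * X 1 ^ j : MvPolynomial (Fin 3) k).IsHomogeneous 12 := by
      simpa [hij] using ((isHomogeneous_X k (0 : Fin 3)).pow i).mul
        ((isHomogeneous_X k (1 : Fin 3)).pow j)
    obtain ⟨F, hF, G, hG, h⟩ := Submodule.mem_sup.mp (mem_monomialSpan_twelve hI h)
    -- Standard monomials have degree at most 10 in x and y, so in degree 12 they are divisible by
    -- z.
    obtain ⟨F', hF', rfl⟩ := exists_X_two_mul_of_mem_monomialSpan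
      (fun p hp => (bitDegreeLE_standardBits p hp).trans (by norm_num)) hF
    exact ⟨F', G, hF', hG, h.symm⟩
  | succ d hd ih =>
    rcases Nat.eq_zero_or_pos i with rfl | hi
    · obtain ⟨F, G, hF, hG, h⟩ := ih (i := 0) (j := d + 1) (by omega)
      refine ⟨X 1 * F, X 1 * G, ?_, I.mul_mem_left _ hG, ?_⟩
      · rw [add_comm d]
        exact (isHomogeneous_X k 1).mul hF
      · rw [show j = d + 1 + 1 by omega, pow_succ, ← mul_assoc, h]
        ring
    · obtain ⟨F, G, hF, hG, h⟩ := ih (i := i - 1) (j := j) (by omega)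
      refine ⟨X 0 * F, X 0 * G, ?_, I.mul_mem_left _ hG, ?_⟩
      · rw [add_comm d]
        exact (isHomogeneous_X k 0).mul hF
      · rw [show i = i - 1 + 1 by omega, pow_succ, mul_right_comm, h]
        ring

/-- Modulo the nonics, the forms of degree `d ≥ 12` are spanned by the standard monomials. -/
theorem mem_monomialSpan (hI : ∀ n ∈ nonics, form k 9 n ∈ I) {d : ℕ} (hd : 12 ≤ d)
    {F : MvPolynomial (Fin 3) k} (hF : F.IsHomogeneous d) :
    F ∈ monomialSpan k d standardBits ⊔ I.restrictScalars k := by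
  induction d, hd using Nat.le_induction generalizing F with
  | base => exact mem_monomialSpan_twelve hI hF
  | succ d hd ih =>
    have hz : ∀ G : MvPolynomial (Fin 3) k, G.IsHomogeneous d →
        X 2 * G ∈ monomialSpan k (d + 1) standardBits ⊔ I.restrictScalars k := by
      intro G hG
      obtain ⟨A, hA, B, hB, rfl⟩ := Submodule.mem_sup.mp (ih hG)
      rw [mul_add]
      exact Submodule.add_mem_sup (X_two_mul_mem_monomialSpan
        (fun p hp => (bitDegreeLE_standardBits p hp).trans (by omega)) hA) (I.mul_mem_left _ hB)
    refine mem_of_monomials (fun i j hij => ?_) hF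
    -- A monomial divisible by z is reduced by induction in degree `d`; one in x and y alone first
    -- becomes a multiple of z modulo the nonics.
    rcases hij.lt_or_eq with h | h
    · rw [show d + 1 - (i + j) = d - (i + j) + 1 by omega, pow_succ', mul_left_comm]
      refine hz _ ?_
      have := (((isHomogeneous_X k (0 : Fin 3)).pow i).mul
        ((isHomogeneous_X k (1 : Fin 3)).pow j)).mul
        ((isHomogeneous_X k (2 : Fin 3)).pow (d - (i + j)))
      rwa [one_mul, one_mul, one_mul, Nat.add_sub_cancel' (by omega)] at this
    · obtain ⟨A, B, hA, hB, hAB⟩ := exists_X_two_mul_add_mem hI (by omega) h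
      rw [h, Nat.sub_self, pow_zero, mul_one, hAB]
      exact add_mem (hz A hA) (Submodule.mem_sup_right hB)

end PlaneSystem
end

/-! ### Fat points in the affine plane -/

noncomputable section

namespace PlaneSystem

variable {K : Type*} [Field K]

/-- The translation `f ↦ f (X + q)` of polynomials on the affine plane. -/
def translate (q : Fin 2 → K) : MvPolynomial (Fin 2) K →ₐ[K] MvPolynomial (Fin 2) K :=
  aeval fun i => X i + C (q i)

/-- The monomials of degree less than `m` in two variables. -/
abbrev JetIndex (m : ℕ) : Type :=
  {e : ℕ × ℕ // e ∈ (Finset.range m ×ˢ Finset.range m).filter fun e => e.1 + e.2 < m}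

/-- The Taylor coefficients of order less than `m` at the point `q`. -/
def jet (q : Fin 2 → K) (m : ℕ) : MvPolynomial (Fin 2) K →ₗ[K] JetIndex m → K :=
  LinearMap.pi fun e =>
    lcoeff K (Finsupp.single 0 e.1.1 + Finsupp.single 1 e.1.2) ∘ₗ (translate q).toLinearMap

/-- The ideal of the union of the fat points `m i * q i` of the affine plane. -/
def fatIdeal {ι : Type*} (q : ι → Fin 2 → K) (m : ι → ℕ) : Ideal (MvPolynomial (Fin 2) K) :=
  ⨅ i, RingHom.ker (eval (q i)) ^ m i

theorem translate_translate_neg (q : Fin 2 → K) (f : MvPolynomial (Fin 2) K) :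
    translate q (translate (-q) f) = f := by
  have : (translate q).comp (translate (-q)) = AlgHom.id K _ := by
    ext i : 1
    simp [translate, algebraMap_eq]
  exact DFunLike.congr_fun this f

theorem eval_zero_translate (q : Fin 2 → K) (f : MvPolynomial (Fin 2) K) :
    eval 0 (translate q f) = eval q f := by
  rw [translate, aeval_def, ← coe_eval₂Hom, ← RingHom.comp_apply]
  congr 1
  ext i <;> simp [algebraMap_eq]

theorem jet_surjective (q : Fin 2 → K) (m : ℕ) : Function.Surjective (jet q m) := by
  intro c
  refine ⟨translate (-q) (∑ e : JetIndex m,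
    monomial (Finsupp.single 0 e.1.1 + Finsupp.single 1 e.1.2) (c e)), ?_⟩
  ext e
  simp only [jet, LinearMap.pi_apply, LinearMap.comp_apply, AlgHom.toLinearMap_apply,
    translate_translate_neg, lcoeff_apply, coeff_sum, coeff_monomial]
  rw [Finset.sum_eq_single e]
  · simp
  · intro e' _ hne
    rw [if_neg]
    intro h
    refine hne (Subtype.ext (Prod.ext ?_ ?_))
    · simpa using DFunLike.congr_fun h 0
    · simpa using DFunLike.congr_fun h 1
  · simp

/-- Translation carries the maximal ideal of `q` into that of the origin, whose `m`-th power
consists of the polynomials without terms of degree less than `m`. -/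
theorem jet_eq_zero {q : Fin 2 → K} {m : ℕ} {f : MvPolynomial (Fin 2) K}
    (hf : f ∈ RingHom.ker (eval q) ^ m) : jet q m f = 0 := by
  have hle : (RingHom.ker (eval q)).map (translate q).toRingHom ≤ idealOfVars (Fin 2) K := by
    rw [Ideal.map_le_iff_le_comap]
    intro g hg
    rw [Ideal.mem_comap, ← pow_one (idealOfVars _ _), mem_pow_idealOfVars_iff']
    intro x hx
    obtain rfl : x = 0 := by simpa [Finsupp.degree_eq_zero_iff] using hx
    have := eval_zero_translate q g
    rw [RingHom.mem_ker.mp hg, eval_zero] at this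
    exact this
  have h : translate q f ∈ idealOfVars (Fin 2) K ^ m := by
    refine Ideal.pow_right_mono hle m ?_
    rw [← Ideal.map_pow]
    exact Ideal.mem_map_of_mem _ hf
  rw [mem_pow_idealOfVars_iff'] at h
  ext e
  refine h _ ?_
  have := (Finset.mem_filter.mp e.2).2
  simpa using this

theorem ker_eval_injective :
    Function.Injective fun q : Fin 2 → K => RingHom.ker (eval q) := by
  intro q r h
  ext i
  have : X i - C (q i) ∈ RingHom.ker (eval r) := by
    change X i - C (q i) ∈ (fun q : Fin 2 → K => RingHom.ker (eval q)) r
    rw [← h]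
    simp [RingHom.mem_ker]
  rw [RingHom.mem_ker] at this
  simpa [sub_eq_zero, eq_comm] using this

instance isMaximal_ker_eval (q : Fin 2 → K) : (RingHom.ker (eval q)).IsMaximal :=
  RingHom.ker_isMaximal_of_surjective _ fun c => ⟨C c, eval_C c⟩

variable {ι : Type*} [Finite ι] {q : ι → Fin 2 → K} {m : ι → ℕ}

/-- Powers of distinct maximal ideals are coprime, so the Chinese remainder theorem allows the jets
at the different points to be prescribed independently. -/
theorem pi_jet_surjective (hq : Function.Injective q) (m : ι → ℕ) :
    Function.Surjective (LinearMap.pi fun i => jet (q i) (m i)) := by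
  intro c
  choose f hf using fun i => jet_surjective (q i) (m i) (c i)
  obtain ⟨g, hg⟩ := Ideal.exists_forall_sub_mem_ideal
    (I := fun i => RingHom.ker (eval (q i)) ^ m i)
    (fun i j hij => (Ideal.isCoprime_of_isMaximal
      fun h => hij (hq (ker_eval_injective h))).pow) f
  refine ⟨g, funext fun i => ?_⟩
  rw [LinearMap.pi_apply, ← hf i, ← sub_eq_zero, ← map_sub, jet_eq_zero (hg i)]

/-- The ideal of a union of fat points has codimension at least the degree of that union, so that
a family of at most that size which spans modulo the ideal is independent modulo the ideal. -/
theorem eq_zero_of_sum_mem_fatIdeal [Fintype ι] (hq : Function.Injective q) {β : Type*} [Fintype β]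
    {v : β → MvPolynomial (Fin 2) K}
    (hv : ∀ f, f ∈ Submodule.span K (Set.range v) ⊔ (fatIdeal q m).restrictScalars K)
    (hcard : Fintype.card β ≤ ∑ i, Fintype.card (JetIndex (m i))) {c : β → K}
    (hc : ∑ i, c i • v i ∈ fatIdeal q m) : c = 0 := by
  set Ψ := LinearMap.pi fun i => jet (q i) (m i)
  have hker : ∀ f ∈ fatIdeal q m, Ψ f = 0 := fun f hf =>
    funext fun i => jet_eq_zero (Ideal.mem_iInf.mp hf i)
  -- The images of the `v i` span the jet space, and there are at most as many of them as its
  -- dimension.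
  have hli : LinearIndependent K (Ψ ∘ v) := by
    refine linearIndependent_of_top_le_span_of_card_le_finrank (fun t _ => ?_) ?_
    · obtain ⟨f, rfl⟩ := pi_jet_surjective hq m t
      obtain ⟨g, hg, h, hh, rfl⟩ := Submodule.mem_sup.mp (hv f)
      rw [map_add, hker h hh, add_zero, Set.range_comp, ← Submodule.map_span]
      exact Submodule.mem_map_of_mem hg
    · simpa [Module.finrank_pi_fintype] using hcard
  rw [Fintype.linearIndependent_iff] at hli
  exact funext (hli c (by simpa using hker _ hc))

/-- A prime ideal containing a finite intersection of powers contains one of their bases, here a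
maximal ideal. -/
theorem mem_range_of_fatIdeal_le (hm : ∀ i, m i ≠ 0) {p : Fin 2 → K}
    (h : fatIdeal q m ≤ RingHom.ker (eval p)) : p ∈ Set.range q := by
  cases nonempty_fintype ι
  rw [fatIdeal, ← Finset.inf_univ_eq_iInf, (isMaximal_ker_eval p).isPrime.inf_le'] at h
  obtain ⟨i, -, hi⟩ := h
  have := (Ideal.IsPrime.pow_le_iff (hm i)).mp hi
  exact ⟨i, ker_eval_injective ((isMaximal_ker_eval (q i)).eq_of_le
    (isMaximal_ker_eval p).ne_top this)⟩

end PlaneSystem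

end

/-! ### Fat points in the projective plane -/

noncomputable section

namespace PlaneSystem

variable {K : Type*} [Field K]

/-- Restriction of forms to the affine plane `z = 1`. -/
def dehomogenize (K : Type*) [Field K] : MvPolynomial (Fin 3) K →ₐ[K] MvPolynomial (Fin 2) K :=
  aeval ![X 0, X 1, 1]

theorem eval_dehomogenize (q : Fin 2 → K) (F : MvPolynomial (Fin 3) K) :
    eval q (dehomogenize K F) = eval ![q 0, q 1, 1] F := by
  rw [dehomogenize, aeval_def, ← coe_eval₂Hom, ← RingHom.comp_apply]
  congr 1
  ext i
  · simp [algebraMap_eq]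
  · fin_cases i <;> simp

theorem dehomogenize_mem_of_mem_pointIdeal_pow {q : Fin 2 → K} {m : ℕ}
    {F : MvPolynomial (Fin 3) K} (hF : F ∈ pointIdeal (affinePoint (q 0) (q 1)) ^ m) :
    dehomogenize K F ∈ RingHom.ker (eval q) ^ m := by
  have hle : (pointIdeal (affinePoint (q 0) (q 1))).map (dehomogenize K).toRingHom ≤
      RingHom.ker (eval q) := by
    rw [Ideal.map_le_iff_le_comap, pointIdeal, Ideal.span_le]
    rintro l ⟨-, hl⟩
    have := hl ![q 0, q 1, 1] (by
      rw [affinePoint, Projectivization.submodule_mk]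
      exact Submodule.mem_span_singleton_self _)
    change eval q (dehomogenize K l) = 0
    rwa [eval_dehomogenize]
  refine Ideal.pow_right_mono hle m ?_
  rw [← Ideal.map_pow]
  exact Ideal.mem_map_of_mem _ hF

theorem aeval_eq_zero_of_mem_pointIdeal {p : Plane K} {F : MvPolynomial (Fin 3) K}
    (hF : F ∈ pointIdeal p) : VanishesAt F p := by
  intro v hv
  have : pointIdeal p ≤ RingHom.ker (aeval v : MvPolynomial (Fin 3) K →ₐ[K] K) :=
    Ideal.span_le.mpr fun l hl => hl.2 v hv
  exact this hF

theorem X_sub_mem_pointIdeal (x y : K) :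
    X 0 - C x * X 2 ∈ pointIdeal (affinePoint x y) ∧
      X 1 - C y * X 2 ∈ pointIdeal (affinePoint x y) := by
  have hom (i : Fin 3) (c : K) : (X i - C c * X 2 : MvPolynomial (Fin 3) K).IsHomogeneous 1 := by
    refine (isHomogeneous_X K i).sub ?_
    simpa using (isHomogeneous_C (Fin 3) c).mul (isHomogeneous_X K 2)
  refine ⟨Ideal.subset_span ⟨hom 0 x, fun v hv => ?_⟩,
    Ideal.subset_span ⟨hom 1 y, fun v hv => ?_⟩⟩ <;>
  · rw [affinePoint, Projectivization.submodule_mk] at hv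
    obtain ⟨c, rfl⟩ := Submodule.mem_span_singleton.mp hv
    simp [mul_comm]

/-- Projection of forms to the line through the point `(x : y : 1)`. -/
def restrictLine (x y : K) : MvPolynomial (Fin 3) K →ₐ[K] MvPolynomial (Fin 3) K :=
  aeval ![C x * X 2, C y * X 2, X 2]

theorem restrictLine_eq (x y : K) {d : ℕ} {F : MvPolynomial (Fin 3) K} (hF : F.IsHomogeneous d) :
    restrictLine x y F = C (eval ![x, y, 1] F) * X 2 ^ d := by
  let N : Submodule K (MvPolynomial (Fin 3) K) :=
    LinearMap.eqLocus (restrictLine x y).toLinearMap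
      (LinearMap.mulRight K (X 2 ^ d) ∘ₗ (Algebra.linearMap K (MvPolynomial (Fin 3) K)) ∘ₗ
        (aeval ![x, y, 1]).toLinearMap)
  refine mem_of_monomials (N := N) (fun i j hij => ?_) hF
  change restrictLine x y _ = C (aeval ![x, y, 1] _) * X 2 ^ d
  simp only [restrictLine, map_mul, map_pow, aeval_X]
  simp only [Matrix.cons_val, mul_pow]
  nth_rw 3 [show d = i + j + (d - (i + j)) by omega]
  rw [pow_add, pow_add]
  simp
  ring

/-- The Taylor expansion of first order of a form along the line through `(x : y : 1)`. -/
theorem sub_taylor_mem (x y : K) (F : MvPolynomial (Fin 3) K) :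
    F - (restrictLine x y F + restrictLine x y (pderiv 0 F) * (X 0 - C x * X 2) +
      restrictLine x y (pderiv 1 F) * (X 1 - C y * X 2)) ∈
        pointIdeal (affinePoint x y) ^ 2 := by
  obtain ⟨hu, hv⟩ := X_sub_mem_pointIdeal x y
  set I := pointIdeal (affinePoint x y)
  set u : MvPolynomial (Fin 3) K := X 0 - C x * X 2 with hu'
  set v : MvPolynomial (Fin 3) K := X 1 - C y * X 2 with hv'
  induction F using MvPolynomial.induction_on with
  | C c => simp [restrictLine, algebraMap_eq]
  | add F G hF hG =>
    convert add_mem hF hG using 1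
    simp only [map_add]
    ring
  -- The product rule leaves only terms with a factor u², uv or v², which lie in the square of the
  -- ideal.
  | mul_X F i hF =>
    have huu : u * u ∈ I ^ 2 := by rw [pow_two]; exact Ideal.mul_mem_mul hu hu
    have huv : u * v ∈ I ^ 2 := by rw [pow_two]; exact Ideal.mul_mem_mul hu hv
    have hvv : v * v ∈ I ^ 2 := by rw [pow_two]; exact Ideal.mul_mem_mul hv hv
    have h2 : X 0 = restrictLine x y (X 0) + u := by simp [restrictLine, hu']
    have h3 : X 1 = restrictLine x y (X 1) + v := by simp [restrictLine, hv']
    have h4 : (X 2 : MvPolynomial (Fin 3) K) = restrictLine x y (X 2) := by simp [restrictLine]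
    set τ := restrictLine x y
    fin_cases i
    · convert add_mem (Ideal.mul_mem_left _ (X 0) hF) (add_mem
        (Ideal.mul_mem_left _ (τ (pderiv 0 F)) huu) (Ideal.mul_mem_left _ (τ (pderiv 1 F)) huv))
        using 1
      simp [pderiv_X]
      linear_combination (τ F + τ (pderiv 0 F) * u + τ (pderiv 1 F) * v) * h2
    · convert add_mem (Ideal.mul_mem_left _ (X 1) hF) (add_mem
        (Ideal.mul_mem_left _ (τ (pderiv 0 F)) huv) (Ideal.mul_mem_left _ (τ (pderiv 1 F)) hvv))
        using 1
      simp [pderiv_X]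
      linear_combination (τ F + τ (pderiv 0 F) * u + τ (pderiv 1 F) * v) * h3
    · convert Ideal.mul_mem_left _ (X 2) hF using 1
      simp [pderiv_X]
      linear_combination (τ F + τ (pderiv 0 F) * u + τ (pderiv 1 F) * v) * h4

/-- The expansion is around the line z ↦ (xz, yz, z), so the derivative in z does not enter and no
assumption on the characteristic is needed. -/
theorem mem_pointIdeal_sq {x y : K} {d : ℕ} {F : MvPolynomial (Fin 3) K} (hF : F.IsHomogeneous d)
    (h : eval ![x, y, 1] F = 0) (hx : eval ![x, y, 1] (pderiv 0 F) = 0)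
    (hy : eval ![x, y, 1] (pderiv 1 F) = 0) : F ∈ pointIdeal (affinePoint x y) ^ 2 := by
  simpa [restrictLine_eq x y hF, restrictLine_eq x y hF.pderiv, h, hx, hy]
    using sub_taylor_mem x y F

theorem mem_pointIdeal {x y : K} {d : ℕ} {F : MvPolynomial (Fin 3) K} (hF : F.IsHomogeneous d)
    (h : eval ![x, y, 1] F = 0) : F ∈ pointIdeal (affinePoint x y) := by
  have h2 := Ideal.pow_le_self two_ne_zero (sub_taylor_mem x y F)
  obtain ⟨hu, hv⟩ := X_sub_mem_pointIdeal x y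
  rw [restrictLine_eq x y hF, h, C_0, zero_mul, zero_add] at h2
  simpa using add_mem h2 (add_mem (Ideal.mul_mem_left _ (restrictLine x y (pderiv 0 F)) hu)
    (Ideal.mul_mem_left _ (restrictLine x y (pderiv 1 F)) hv))

end PlaneSystem

end

/-! ### The assigned points -/

noncomputable section

namespace PlaneSystem

/-! ### Multiplicative orders of the two roots -/

section FieldArithmetic

variable {K : Type*} [Field K]

theorem bitSum_pow_eq_zero_fourteen {a : K}
    -- The number 27987 has binary digits 1 at the exponents of this polynomial; likewise 47 for the
    -- quintic.
    (ha : a ^ 14 + a ^ 13 + a ^ 11 + a ^ 10 + a ^ 8 + a ^ 6 + a ^ 4 + a + 1 = 0) :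
    bitSum (a ^ ·) 27987 = 0 := by
  rw [bitSum, show bitList 27987 = [0, 1, 4, 6, 8, 10, 11, 13, 14] by decide +kernel]
  simp only [List.map_cons, List.map_nil, List.sum_cons, List.sum_nil]
  linear_combination ha

theorem bitSum_pow_eq_zero_five {b : K} (hb : b ^ 5 + b ^ 3 + b ^ 2 + b + 1 = 0) :
    bitSum (b ^ ·) 47 = 0 := by
  rw [bitSum, show bitList 47 = [0, 1, 2, 3, 5] by decide +kernel]
  simp only [List.map_cons, List.map_nil, List.sum_cons, List.sum_nil]
  linear_combination hb

theorem ne_zero_of_orderOf_ne_zero {a : K} (h : orderOf a ≠ 0) : a ≠ 0 := by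
  rintro rfl
  have := pow_orderOf_eq_one (0 : K)
  rw [zero_pow h] at this
  exact zero_ne_one this

theorem bitSum_pow_one (a : K) : bitSum (a ^ ·) 1 = 1 := by
  simpa using bitSum_two_pow (a ^ ·) 0

variable [CharP K 2]

theorem pow_eq_one_of_bitPow {a : K} {f r s e : ℕ} (hf : bitSum (a ^ ·) f = 0) (he : e < 2 ^ s)
    (h : bitPow f r s e = 1) : a ^ e = 1 := by
  rw [← bitSum_pow_bitPow hf r he, h, bitSum_pow_one]

/-- If `t ^ e - 1` has the inverse `g` modulo `f`, then `a ^ e ≠ 1` for every root `a` of `f`. -/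
theorem pow_ne_one_of_bitPow {a : K} {f r s e g : ℕ} (hf : bitSum (a ^ ·) f = 0) (he : e < 2 ^ s)
    (h : bitMod f r (bitMul g (bitPow f r s e ^^^ 1)) = 1) : a ^ e ≠ 1 := by
  intro h1
  have := congrArg (bitSum (a ^ ·)) h
  rw [bitSum_pow_bitMod hf, bitSum_pow_bitMul, bitSum_xor, bitSum_pow_bitPow hf r he,
    bitSum_pow_one, h1, CharTwo.add_self_eq_zero, mul_zero] at this
  exact zero_ne_one this

/-- For each prime p dividing 16383 = 2^14 - 1, the number `g` encodes an inverse of t^(16383/p) - 1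
modulo the polynomial. Irreducibility of the polynomial is not needed. -/
theorem orderOf_fourteen {a : K} (ha : bitSum (a ^ ·) 27987 = 0) : orderOf a = 16383 := by
  refine orderOf_eq_of_pow_and_pow_div_prime (by norm_num)
    (pow_eq_one_of_bitPow (r := 14) (s := 14) ha (by norm_num) (by decide +kernel)) ?_
  intro p hp hdvd
  have hp' : p ∈ Nat.primeFactors 16383 := Nat.mem_primeFactors.mpr ⟨hp, hdvd, by norm_num⟩
  rw [show (16383 : ℕ) = 3 * 43 * 127 by norm_num, Nat.primeFactors_mul (by norm_num) (by norm_num),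
    Nat.primeFactors_mul (by norm_num) (by norm_num), Nat.Prime.primeFactors (by norm_num),
    Nat.Prime.primeFactors (by norm_num), Nat.Prime.primeFactors (by norm_num)] at hp'
  simp only [Finset.mem_union, Finset.mem_singleton] at hp'
  rcases hp' with (rfl | rfl) | rfl
  · exact pow_ne_one_of_bitPow (r := 14) (s := 14) (g := 13793) ha (by norm_num) (by decide +kernel)
  · exact pow_ne_one_of_bitPow (r := 14) (s := 14) (g := 14181) ha (by norm_num) (by decide +kernel)
  · exact pow_ne_one_of_bitPow (r := 14) (s := 14) (g := 8312) ha (by norm_num) (by decide +kernel)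

theorem pow_eq_one_five {b : K} (hb : bitSum (b ^ ·) 47 = 0) : b ^ 31 = 1 :=
  pow_eq_one_of_bitPow (r := 5) (s := 5) hb (by norm_num) (by decide +kernel)

theorem orderOf_five {b : K} (hb : bitSum (b ^ ·) 47 = 0) : orderOf b = 31 :=
  haveI : Fact (Nat.Prime 31) := ⟨by norm_num⟩
  orderOf_eq_prime (pow_eq_one_five hb) fun h =>
    pow_ne_one_of_bitPow (r := 5) (s := 5) (e := 1) (g := 26) hb (by norm_num)
      (by decide +kernel) (by rw [h, one_pow])

end FieldArithmetic

/-! ### Distinctness of the twenty points -/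

section Coordinates

variable {K : Type*} [Field K]

/-- The affine coordinates of the assigned points. -/
def assignedCoord (a b : K) : Unit ⊕ Fin 14 ⊕ Fin 5 → Fin 2 → K :=
  Sum.elim (fun _ => ![0, 0])
    (Sum.elim (fun i => ![(a ^ 11898) ^ 2 ^ (i : ℕ), (a ^ 137) ^ 2 ^ (i : ℕ)])
      (fun i => ![(b ^ 6) ^ 2 ^ (i : ℕ), (b ^ 15) ^ 2 ^ (i : ℕ)]))

theorem assignedPoint_eq (a b : K) (i : Unit ⊕ Fin 14 ⊕ Fin 5) :
    assignedPoint a b i = affinePoint (assignedCoord a b i 0) (assignedCoord a b i 1) := by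
  rcases i with i | i | i <;> rfl

theorem affinePoint_injective {x y x' y' : K} (h : affinePoint x y = affinePoint x' y') :
    x = x' ∧ y = y' := by
  obtain ⟨c, hc⟩ := (Projectivization.mk_eq_mk_iff' K _ _ _ _).mp h
  have h2 : c = 1 := by simpa using congrFun hc 2
  subst h2
  have h0 := congrFun hc 0
  have h1 := congrFun hc 1
  simp only [one_smul, Matrix.cons_val] at h0 h1
  exact ⟨h0.symm, h1.symm⟩

theorem injective_of_pow_two_pow {x : K} {e n r : ℕ} (hn : orderOf x = n) (hn0 : 0 < n)
    (h : ∀ i j : Fin r, e * 2 ^ (i : ℕ) % n = e * 2 ^ (j : ℕ) % n → i = j) {i j : Fin r}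
    (hij : (x ^ e) ^ 2 ^ (i : ℕ) = (x ^ e) ^ 2 ^ (j : ℕ)) : i = j := by
  rw [← pow_mul, ← pow_mul, ← pow_mod_orderOf, ← pow_mod_orderOf x (e * 2 ^ (j : ℕ)), hn] at hij
  refine h i j (pow_injOn_Iio_orderOf ?_ ?_ hij) <;>
  · rw [Set.mem_Iio, hn]
    exact Nat.mod_lt _ hn0

theorem assignedCoord_injective [CharP K 2] {a b : K} (ha : bitSum (a ^ ·) 27987 = 0)
    (hb : bitSum (b ^ ·) 47 = 0) : Function.Injective (assignedCoord a b) := by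
  have oa := orderOf_fourteen ha
  have ob := orderOf_five hb
  have ha0 : a ≠ 0 := ne_zero_of_orderOf_ne_zero (by simp [oa])
  have hb0 : b ≠ 0 := ne_zero_of_orderOf_ne_zero (by simp [ob])
  -- The right side is a 31st root of unity, whereas 16383 does not divide 137·2^i·31.
  have hab : ∀ (i : Fin 14) (j : ℕ), (a ^ 137) ^ 2 ^ (i : ℕ) ≠ (b ^ 15) ^ 2 ^ j := by
    intro i j h
    have h1 := congrArg (· ^ 31) h
    simp only [← pow_mul] at h1
    rw [mul_comm (15 * 2 ^ j), pow_mul b, pow_eq_one_five hb, one_pow] at h1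
    have h2 := orderOf_dvd_of_pow_eq_one h1
    rw [oa] at h2
    clear h h1
    revert i
    decide +kernel
  intro i j h
  -- The second coordinates alone already separate the twenty points.
  have h1 := congrFun h 1
  rcases i with i | i | i <;> rcases j with j | j | j <;>
    simp only [assignedCoord, Sum.elim_inl, Sum.elim_inr, Matrix.cons_val] at h1
  · rfl
  · exact absurd h1.symm (by positivity)
  · exact absurd h1.symm (by positivity)
  · exact absurd h1 (by positivity)
  · rw [injective_of_pow_two_pow oa (by norm_num) (by decide +kernel) h1]
  · exact absurd h1 (hab i j)
  · exact absurd h1 (by positivity)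
  · exact absurd h1.symm (hab j i)
  · rw [injective_of_pow_two_pow ob (by norm_num) (by decide +kernel) h1]

theorem assignedPoint_injective [CharP K 2] {a b : K} (ha : bitSum (a ^ ·) 27987 = 0)
    (hb : bitSum (b ^ ·) 47 = 0) : Function.Injective (assignedPoint a b) := by
  intro i j h
  rw [assignedPoint_eq, assignedPoint_eq] at h
  obtain ⟨h0, h1⟩ := affinePoint_injective h
  refine assignedCoord_injective ha hb (funext fun t => ?_)
  fin_cases t
  · exact h0
  · exact h1

end Coordinates

/-! ### Values and derivatives of forms along Frobenius orbits -/

section Evaluation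

variable {K : Type*} [Field K]

/-- The sum of the monomials of `n` at the point `(x, y)`, with weights `c`. -/
def weightedSum (c : ℕ → ℕ) (x y : K) (n : ℕ) : K :=
  bitSum (fun p => (c p : K) * (x ^ (p % 16) * y ^ (p / 16))) n

/-- The weighted sum of the monomials of `n` at the point `(t ^ A, t ^ B)` in `𝔽₂[t]` modulo the
polynomial `f` of degree `r`. -/
def weightedBits (f r s A B : ℕ) (c : ℕ → ℕ) (n : ℕ) : ℕ :=
  xorSum ((bitList n).map fun p =>
    if c p % 2 = 1 then bitPow f r s (A * (p % 16) + B * (p / 16)) else 0)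

theorem eval_form (x y : K) (d n : ℕ) :
    eval ![x, y, 1] (form K d n) = weightedSum (fun _ => 1) x y n := by
  rw [form, map_bitSum, weightedSum]
  simp [formMonomial]

/-- Multiplying the derivative by x restores the monomials, so it becomes a weighted sum of the same
shape as the value itself. -/
theorem eval_pderiv_zero_form (x y : K) (d n : ℕ) :
    x * eval ![x, y, 1] (pderiv 0 (form K d n)) = weightedSum (· % 16) x y n := by
  rw [form, map_bitSum, map_bitSum, weightedSum, mul_bitSum]
  refine bitSum_congr fun p _ => ?_
  rcases h : p % 16 with _ | e <;> simp [formMonomial, pderiv_X, h]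
  ring

theorem eval_pderiv_one_form (x y : K) (d n : ℕ) :
    y * eval ![x, y, 1] (pderiv 1 (form K d n)) = weightedSum (· / 16) x y n := by
  rw [form, map_bitSum, map_bitSum, weightedSum, mul_bitSum]
  refine bitSum_congr fun p _ => ?_
  rcases h : p / 16 with _ | e <;> simp [formMonomial, pderiv_X, h]
  ring

variable [CharP K 2]

/-- The weights lie in the prime field, hence are fixed by Frobenius. Vanishing therefore needs to
be checked at only one point of each orbit. -/
theorem weightedSum_pow (c : ℕ → ℕ) (x y : K) (n i : ℕ) :
    weightedSum c (x ^ 2 ^ i) (y ^ 2 ^ i) n = weightedSum c x y n ^ 2 ^ i := by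
  have : Fact (Nat.Prime 2) := ⟨Nat.prime_two⟩
  rw [← iterateFrobenius_def 2 i (weightedSum c x y n), weightedSum, weightedSum, map_bitSum]
  refine bitSum_congr fun p _ => ?_
  rw [map_mul, map_natCast, iterateFrobenius_def, mul_pow, ← pow_mul, ← pow_mul, ← pow_mul,
    ← pow_mul, mul_comm (2 ^ i), mul_comm (2 ^ i)]

theorem weightedSum_eq_zero {a : K} {f r s A B d : ℕ} (hf : bitSum (a ^ ·) f = 0) {c : ℕ → ℕ}
    {n : ℕ} (hn : BitDegreeLE n d) (hs : (A + B) * d < 2 ^ s)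
    (h : weightedBits f r s A B c n = 0) : weightedSum c (a ^ A) (a ^ B) n = 0 := by
  rw [← bitSum_zero (a ^ ·), ← h, weightedBits, bitSum_xorSum, List.map_map, weightedSum, bitSum]
  refine congrArg List.sum (List.map_congr_left fun p hp => ?_)
  have hp' := hn p hp
  have hlt : A * (p % 16) + B * (p / 16) < 2 ^ s := by
    refine lt_of_le_of_lt ?_ hs
    rw [add_mul]
    exact Nat.add_le_add (Nat.mul_le_mul_left _ (by omega)) (Nat.mul_le_mul_left _ (by omega))
  have hc : (c p : K) = if c p % 2 = 1 then 1 else 0 := by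
    have h2 : ((2 : ℕ) : K) = 0 := CharP.cast_eq_zero K 2
    conv_lhs => rw [← Nat.mod_add_div (c p) 2, Nat.cast_add, Nat.cast_mul, h2, zero_mul, add_zero]
    rcases Nat.mod_two_eq_zero_or_one (c p) with h | h <;> simp [h]
  rw [Function.comp_apply, hc]
  split_ifs
  · rw [bitSum_pow_bitPow hf r hlt, one_mul, pow_add, pow_mul, pow_mul]
  · rw [bitSum_zero, zero_mul]

end Evaluation

/-! ### Membership of the nonics in the linear system -/

section Membership

theorem weightedBits_nonics_fourteen : ∀ n ∈ nonics,
    -- Exponents are not reduced modulo the order of the root: 17 bits suffice because (11898 +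
    -- 137)·9 < 2^17. For R, 8 bits suffice because (6 + 15)·9 < 2^8.
    weightedBits 27987 14 17 11898 137 (fun _ => 1) n = 0 ∧
    weightedBits 27987 14 17 11898 137 (· % 16) n = 0 ∧
    weightedBits 27987 14 17 11898 137 (· / 16) n = 0 := by decide +kernel

theorem weightedBits_nonics_five : ∀ n ∈ nonics,
    weightedBits 47 5 8 6 15 (fun _ => 1) n = 0 := by decide +kernel

theorem three_le_nonics : ∀ n ∈ nonics, ∀ p ∈ bitList n, 3 ≤ p % 16 + p / 16 := by decide +kernel

/-- At P the ideal is generated by x and y, so multiplicity is read off the monomials. -/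
theorem form_mem_pointIdeal_pow {K : Type*} [Field K] {d m n : ℕ}
    (h : ∀ p ∈ bitList n, m ≤ p % 16 + p / 16) :
    form K d n ∈ pointIdeal (affinePoint (0 : K) 0) ^ m := by
  obtain ⟨hx, hy⟩ := X_sub_mem_pointIdeal (0 : K) 0
  rw [C_0, zero_mul, sub_zero] at hx hy
  refine bitSum_mem fun p hp => Ideal.mul_mem_right _ _ ?_
  refine Ideal.pow_le_pow_right (h p (mem_bitList.mpr hp)) ?_
  rw [pow_add]
  exact Ideal.mul_mem_mul (Ideal.pow_mem_pow hx _) (Ideal.pow_mem_pow hy _)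

theorem form_nonic_mem {K : Type*} [Field K] [CharP K 2] {a b : K}
    (ha : bitSum (a ^ ·) 27987 = 0) (hb : bitSum (b ^ ·) 47 = 0) {n : ℕ} (hn : n ∈ nonics)
    (i : Unit ⊕ Fin 14 ⊕ Fin 5) :
    form K 9 n ∈ pointIdeal (assignedPoint a b i) ^ assignedMult i := by
  have hdeg := bitDegreeLE_nonics n hn
  have hom := isHomogeneous_form (k := K) hdeg
  rcases i with i | i | i
  · exact form_mem_pointIdeal_pow (three_le_nonics n hn)
  · have ha0 : a ≠ 0 := ne_zero_of_orderOf_ne_zero (by simp [orderOf_fourteen ha])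
    obtain ⟨h1, h2, h3⟩ := weightedBits_nonics_fourteen n hn
    have key {c : ℕ → ℕ} (hc : weightedBits 27987 14 17 11898 137 c n = 0) :
        weightedSum c ((a ^ 11898) ^ 2 ^ (i : ℕ)) ((a ^ 137) ^ 2 ^ (i : ℕ)) n = 0 := by
      rw [weightedSum_pow, weightedSum_eq_zero ha hdeg (by norm_num) hc,
        zero_pow (by positivity)]
    refine mem_pointIdeal_sq hom ?_ ?_ ?_
    · rw [eval_form, key h1]
    -- Both coordinates of each Q_i are nonzero, so the extra factor x or y can be cancelled.
    · refine (mul_eq_zero_iff_left (a := (a ^ 11898) ^ 2 ^ (i : ℕ)) (by positivity)).mp ?_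
      rw [eval_pderiv_zero_form, key h2]
    · refine (mul_eq_zero_iff_left (a := (a ^ 137) ^ 2 ^ (i : ℕ)) (by positivity)).mp ?_
      rw [eval_pderiv_one_form, key h3]
  · have h1 := weightedBits_nonics_five n hn
    change _ ∈ pointIdeal (affinePoint _ _) ^ 1
    rw [pow_one]
    refine mem_pointIdeal hom ?_
    rw [eval_form, weightedSum_pow, weightedSum_eq_zero hb hdeg (by norm_num) h1,
      zero_pow (by positivity)]

theorem map_form {k K : Type*} [Field k] [Field K] (φ : k →+* K) (d n : ℕ) :
    map φ (form k d n) = form K d n := by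
  rw [form, form, map_bitSum]
  exact bitSum_congr fun p _ => by simp [formMonomial]

theorem form_nonic_mem_linearSystem (k : Type*) {K : Type*} [Field k] [Field K] [CharP K 2]
    [Algebra k K] {a b : K} (ha : bitSum (a ^ ·) 27987 = 0) (hb : bitSum (b ^ ·) 47 = 0) {n : ℕ}
    (hn : n ∈ nonics) : form k 9 n ∈ linearSystem k 9 (assignedPoint a b) assignedMult :=
  ⟨isHomogeneous_form (bitDegreeLE_nonics n hn), fun i => by
    rw [map_form]; exact form_nonic_mem ha hb hn i⟩

end Membership

end PlaneSystem

end

/-! ### The linear system of nonics -/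

noncomputable section

namespace PlaneSystem

/-! ### Standard monomials in the affine chart -/

section Affine

variable {K : Type*} [Field K]

/-- The standard monomials on the affine plane. -/
def affineMonomial (K : Type*) [Field K] (p : (bitList standardBits).toFinset) :
    MvPolynomial (Fin 2) K :=
  X 0 ^ ((p : ℕ) % 16) * X 1 ^ ((p : ℕ) / 16)

theorem card_standardBits : Fintype.card (bitList standardBits).toFinset = 53 := by
  have h : (bitList standardBits).Nodup := List.nodup_range.filter _
  rw [Fintype.card_coe, List.toFinset_card_of_nodup h, length_bitList_standardBits]

theorem dehomogenize_surjective : Function.Surjective (dehomogenize K) := by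
  intro f
  refine ⟨aeval ![X 0, X 1] f, ?_⟩
  have : (dehomogenize K).comp (aeval ![X 0, X 1]) = AlgHom.id K _ := by
    ext i : 1
    fin_cases i <;> simp [dehomogenize]
  exact DFunLike.congr_fun this f

theorem dehomogenize_formMonomial (d : ℕ) (p : (bitList standardBits).toFinset) :
    dehomogenize K (formMonomial K d p) = affineMonomial K p := by
  simp [dehomogenize, formMonomial, affineMonomial]

theorem monomialSpan_standardBits (k : Type*) [Field k] (d : ℕ) :
    monomialSpan k d standardBits = Submodule.span k
      (Set.range fun p : (bitList standardBits).toFinset => formMonomial k d p) := by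
  rw [monomialSpan]
  congr 1
  ext F
  constructor
  · rintro ⟨p, hp, rfl⟩
    exact ⟨⟨p, List.mem_toFinset.mpr (mem_bitList.mpr hp)⟩, rfl⟩
  · rintro ⟨p, rfl⟩
    exact ⟨p, mem_bitList.mp (List.mem_toFinset.mp p.2), rfl⟩

variable [CharP K 2]

/-- The standard monomials span the affine coordinate ring modulo the nonics. -/
theorem mem_span_affineMonomial {I : Ideal (MvPolynomial (Fin 3) K)}
    (hI : ∀ n ∈ nonics, form K 9 n ∈ I) (f : MvPolynomial (Fin 2) K) :
    f ∈ Submodule.span K (Set.range (affineMonomial K)) ⊔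
      (I.map (dehomogenize K).toRingHom).restrictScalars K := by
  obtain ⟨F, rfl⟩ := dehomogenize_surjective f
  rw [← sum_homogeneousComponent F, map_sum]
  refine sum_mem fun d _ => ?_
  -- The factor z^12 becomes 1 in the chart and raises the degree to the range where division by the
  -- nonics is available.
  have hom : (X 2 ^ 12 * homogeneousComponent d F).IsHomogeneous (12 + d) := by
    simpa using ((isHomogeneous_X K (2 : Fin 3)).pow 12).mul (homogeneousComponent_isHomogeneous d F)
  have h1 : dehomogenize K (homogeneousComponent d F) =
      dehomogenize K (X 2 ^ 12 * homogeneousComponent d F) := by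
    simp [dehomogenize]
  obtain ⟨S, hS, G, hG, h⟩ := Submodule.mem_sup.mp
    (mem_monomialSpan hI (Nat.le_add_right 12 d) hom)
  rw [h1, ← h, map_add]
  refine Submodule.add_mem_sup ?_ (Ideal.mem_map_of_mem _ hG)
  rw [monomialSpan_standardBits] at hS
  have := Submodule.mem_map_of_mem (f := (dehomogenize K).toLinearMap) hS
  rw [Submodule.map_span, ← Set.range_comp] at this
  rwa [show (dehomogenize K).toLinearMap ∘ (fun p : (bitList standardBits).toFinset =>
    formMonomial K (12 + d) p) = affineMonomial K from funext (dehomogenize_formMonomial _)] at this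

end Affine

/-! ### Independence, dimension, Hilbert function and base points -/

section System

variable {k K : Type*} [Field k] [Field K] [Algebra k K] {a b : K}

/-- The ideal of the assigned fat points in the affine plane. -/
abbrev assignedIdeal (a b : K) : Ideal (MvPolynomial (Fin 2) K) :=
  fatIdeal (assignedCoord a b) assignedMult

theorem dehomogenize_mem_assignedIdeal {d : ℕ} {F : MvPolynomial (Fin 3) k}
    (hF : F ∈ linearSystem k d (assignedPoint a b) assignedMult) :
    dehomogenize K (map (algebraMap k K) F) ∈ assignedIdeal a b := by
  refine Ideal.mem_iInf.mpr fun i => dehomogenize_mem_of_mem_pointIdeal_pow ?_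
  rw [← assignedPoint_eq]
  exact hF.2 i

theorem dehomogenize_mem_of_mem_baseIdeal {F : MvPolynomial (Fin 3) k}
    (hF : F ∈ baseIdeal (linearSystem k 9 (assignedPoint a b) assignedMult)) :
    dehomogenize K (map (algebraMap k K) F) ∈ assignedIdeal a b := by
  have : baseIdeal (linearSystem k 9 (assignedPoint a b) assignedMult) ≤
      (assignedIdeal a b).comap ((dehomogenize K).toRingHom.comp (map (algebraMap k K))) :=
    Ideal.span_le.mpr fun G hG => dehomogenize_mem_assignedIdeal hG
  exact this hF

theorem aeval_eq_eval_form (v : Fin 3 → K) (d n : ℕ) :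
    aeval v (form k d n) = eval v (form K d n) := by
  rw [← map_form (algebraMap k K), eval_map, aeval_def]

variable [CharP K 2]

theorem dehomogenize_mem_of_mem_span (ha : bitSum (a ^ ·) 27987 = 0)
    (hb : bitSum (b ^ ·) 47 = 0) :
    (Ideal.span (form K 9 '' {n | n ∈ nonics})).map (dehomogenize K).toRingHom ≤
      assignedIdeal a b := by
  rw [Ideal.map_le_iff_le_comap, Ideal.span_le]
  rintro _ ⟨n, hn, rfl⟩
  have := dehomogenize_mem_assignedIdeal (form_nonic_mem_linearSystem K ha hb hn)
  rwa [map_form] at this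

theorem form_nonic_mem_span (k : Type*) [Field k] :
    ∀ n ∈ nonics, form k 9 n ∈ Ideal.span (form k 9 '' {n | n ∈ nonics}) :=
  fun n hn => Ideal.subset_span ⟨n, hn, rfl⟩

/-- The standard monomials are independent modulo the ideal of the assigned fat points. -/
theorem eq_zero_of_sum_mem_assignedIdeal (ha : bitSum (a ^ ·) 27987 = 0)
    (hb : bitSum (b ^ ·) 47 = 0) {c : (bitList standardBits).toFinset → K}
    (hc : ∑ p, c p • affineMonomial K p ∈ assignedIdeal a b) : c = 0 := by
  refine eq_zero_of_sum_mem_fatIdeal (assignedCoord_injective ha hb) (fun f => ?_) ?_ hc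
  · obtain ⟨S, hS, G, hG, rfl⟩ := Submodule.mem_sup.mp
      (mem_span_affineMonomial (form_nonic_mem_span K) f)
    exact Submodule.add_mem_sup hS (dehomogenize_mem_of_mem_span ha hb hG)
  · rw [card_standardBits]
    -- The jet spaces have total dimension 6 + 14·3 + 5·1 = 53.
    decide +kernel

/-- Independence over K descends to k because the standard monomials are defined over the prime
field. -/
theorem sum_smul_formMonomial_eq_zero (ha : bitSum (a ^ ·) 27987 = 0)
    (hb : bitSum (b ^ ·) 47 = 0) {d : ℕ} {c : (bitList standardBits).toFinset → k}
    (hc : dehomogenize K (map (algebraMap k K) (∑ p, c p • formMonomial k d p)) ∈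
      assignedIdeal a b) : c = 0 := by
  have : (fun p => algebraMap k K (c p)) = 0 := by
    refine eq_zero_of_sum_mem_assignedIdeal ha hb ?_
    convert hc using 1
    rw [map_sum, map_sum]
    refine Finset.sum_congr rfl fun p _ => ?_
    rw [← dehomogenize_formMonomial d p, ← map_smul]
    congr 1
    rw [smul_eq_C_mul, smul_eq_C_mul, map_mul, map_C]
    simp [formMonomial]
  funext p
  simpa using congrFun this p

theorem eq_zero_of_mem_monomialSpan (ha : bitSum (a ^ ·) 27987 = 0)
    (hb : bitSum (b ^ ·) 47 = 0) {d : ℕ} {F : MvPolynomial (Fin 3) k}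
    (hF : F ∈ monomialSpan k d standardBits)
    (h : dehomogenize K (map (algebraMap k K) F) ∈ assignedIdeal a b) : F = 0 := by
  rw [monomialSpan_standardBits] at hF
  obtain ⟨c, rfl⟩ := (Submodule.mem_span_range_iff_exists_fun k).mp hF
  simp [sum_smul_formMonomial_eq_zero ha hb h]

/-- If a form with the assigned multiplicities is the sum of standard monomials and of an element
of a subspace `N` of the ideal of the fat points, then it lies in `N`. -/
theorem mem_of_mem_monomialSpan_sup (ha : bitSum (a ^ ·) 27987 = 0)
    (hb : bitSum (b ^ ·) 47 = 0) {d : ℕ} {F : MvPolynomial (Fin 3) k}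
    (hF : F ∈ linearSystem k d (assignedPoint a b) assignedMult)
    {N : Submodule k (MvPolynomial (Fin 3) k)}
    (hN : ∀ G ∈ N, dehomogenize K (map (algebraMap k K) G) ∈ assignedIdeal a b)
    (h : F ∈ monomialSpan k d standardBits ⊔ N) : F ∈ N := by
  obtain ⟨S, hS, G, hG, rfl⟩ := Submodule.mem_sup.mp h
  have h1 := sub_mem (dehomogenize_mem_assignedIdeal hF) (hN G hG)
  rw [← map_sub, ← map_sub, add_sub_cancel_right] at h1
  rwa [eq_zero_of_mem_monomialSpan ha hb hS h1, zero_add]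

theorem charP_of_algebra (k K : Type*) [Field k] [Field K] [Algebra k K] [CharP K 2] : CharP k 2 :=
  (algebraMap k K).charP (algebraMap k K).injective 2

theorem linearSystem_le_baseIdeal (ha : bitSum (a ^ ·) 27987 = 0) (hb : bitSum (b ^ ·) 47 = 0)
    {d : ℕ} (hd : 12 ≤ d) {F : MvPolynomial (Fin 3) k}
    (hF : F ∈ linearSystem k d (assignedPoint a b) assignedMult) :
    F ∈ baseIdeal (linearSystem k 9 (assignedPoint a b) assignedMult) := by
  have := charP_of_algebra k K
  exact mem_of_mem_monomialSpan_sup (N := (baseIdeal _).restrictScalars k) ha hb hF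
    (fun G hG => dehomogenize_mem_of_mem_baseIdeal hG)
    (mem_monomialSpan (fun n hn => Ideal.subset_span (form_nonic_mem_linearSystem k ha hb hn))
      hd hF.1)

theorem monomialSpan_standardBitsNine_le (d : ℕ) :
    monomialSpan k d standardBitsNine ≤ monomialSpan k d standardBits :=
  Submodule.span_mono (Set.image_mono fun p hp => standardBitsNine_le p (mem_bitList.mpr hp))

theorem linearSystem_nine_eq_span (ha : bitSum (a ^ ·) 27987 = 0) (hb : bitSum (b ^ ·) 47 = 0) :
    linearSystem k 9 (assignedPoint a b) assignedMult =
      Submodule.span k (Set.range fun i : Fin nonics.length => form k 9 (nonics.get i)) := by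
  have := charP_of_algebra k K
  have hle : Submodule.span k (Set.range fun i : Fin nonics.length => form k 9 (nonics.get i)) ≤
      linearSystem k 9 (assignedPoint a b) assignedMult := by
    rw [Submodule.span_le]
    rintro _ ⟨i, rfl⟩
    exact form_nonic_mem_linearSystem k ha hb (nonics.get_mem i)
  refine le_antisymm (fun F hF => ?_) hle
  have hN : ∀ n ∈ nonics, form k 9 n ∈
      Submodule.span k (Set.range fun i : Fin nonics.length => form k 9 (nonics.get i)) := by
    intro n hn
    obtain ⟨i, rfl⟩ := List.get_of_mem hn
    exact Submodule.subset_span ⟨i, rfl⟩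
  obtain ⟨S, hS, G, hG, h⟩ := Submodule.mem_sup.mp (mem_monomialSpan_nine hN hF.1)
  refine mem_of_mem_monomialSpan_sup ha hb hF
    (fun G hG => dehomogenize_mem_assignedIdeal (hle hG)) ?_
  rw [← h]
  exact Submodule.add_mem_sup (monomialSpan_standardBitsNine_le 9 hS) hG

/-- The coefficients at the leading monomials form the identity matrix, which makes the nonics
independent. Both lists have five entries, so the default `0` is never used. -/
theorem testBit_nonics : ∀ i j : Fin nonics.length,
    (nonics.get i).testBit (nonicLeads.getD j 0) = decide (i = j) := by decide +kernel

theorem coeff_form {d n q : ℕ} :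
    coeff (Finsupp.single 0 (q % 16) + Finsupp.single 1 (q / 16) +
      Finsupp.single 2 (d - (q % 16 + q / 16))) (form k d n) =
        if n.testBit q then 1 else 0 := by
  have h : ∀ p, coeff (Finsupp.single 0 (q % 16) + Finsupp.single 1 (q / 16) +
      Finsupp.single 2 (d - (q % 16 + q / 16))) (formMonomial k d p) = if p = q then 1 else 0 := by
    intro p
    have : formMonomial k d p = monomial (Finsupp.single 0 (p % 16) + Finsupp.single 1 (p / 16) +
      Finsupp.single 2 (d - (p % 16 + p / 16))) 1 := by
      simp [formMonomial, X_pow_eq_monomial, monomial_mul]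
    rw [this, coeff_monomial]
    congr 1
    refine propext ⟨fun h => ?_, fun h => by rw [h]⟩
    have h0 : p % 16 = q % 16 := by simpa using DFunLike.congr_fun h 0
    have h1 : p / 16 = q / 16 := by simpa using DFunLike.congr_fun h 1
    omega
  have := map_bitSum (lcoeff k (Finsupp.single 0 (q % 16) + Finsupp.single 1 (q / 16) +
      Finsupp.single 2 (d - (q % 16 + q / 16)))) (formMonomial k d) n
  simp only [lcoeff_apply, h] at this
  -- The bound is large enough both to contain `q` and to exceed the length of `n`.
  rw [form, this, bitSum_eq_sum _ (N := n + q + 1)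
    (n.lt_two_pow_self.trans_le (Nat.pow_le_pow_right two_pos (by omega)))]
  rw [Finset.sum_eq_single q]
  · simp
  · intro p _ hp
    simp [hp]
  · intro hq
    exact absurd (Finset.mem_range.mpr (by omega)) hq

theorem linearIndependent_nonics (k : Type*) [Field k] :
    LinearIndependent k fun i : Fin nonics.length => form k 9 (nonics.get i) := by
  rw [Fintype.linearIndependent_iff]
  intro c hc j
  have := congrArg (coeff (Finsupp.single 0 (nonicLeads.getD j 0 % 16) +
    Finsupp.single 1 (nonicLeads.getD j 0 / 16) +
      Finsupp.single 2 (9 - (nonicLeads.getD j 0 % 16 + nonicLeads.getD j 0 / 16)))) hc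
  simp only [coeff_sum, coeff_smul, coeff_form, testBit_nonics, coeff_zero] at this
  simpa using this

theorem finrank_linearSystem_nine (ha : bitSum (a ^ ·) 27987 = 0) (hb : bitSum (b ^ ·) 47 = 0) :
    Module.finrank k (linearSystem k 9 (assignedPoint a b) assignedMult) = 5 := by
  rw [linearSystem_nine_eq_span ha hb, finrank_span_eq_card (linearIndependent_nonics k)]
  rfl

theorem hilbertFunction_baseIdeal (ha : bitSum (a ^ ·) 27987 = 0) (hb : bitSum (b ^ ·) 47 = 0)
    {d : ℕ} (hd : 12 ≤ d) :
    hilbertFunction (baseIdeal (linearSystem k 9 (assignedPoint a b) assignedMult)) d = 53 := by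
  have := charP_of_algebra k K
  set I := baseIdeal (linearSystem k 9 (assignedPoint a b) assignedMult)
  have hI : ∀ n ∈ nonics, form k 9 n ∈ I := fun n hn =>
    Ideal.subset_span (form_nonic_mem_linearSystem k ha hb hn)
  have hle : monomialSpan k d standardBits ≤ homogeneousSubmodule (Fin 3) k d := by
    rw [monomialSpan, Submodule.span_le]
    rintro _ ⟨p, hp, rfl⟩
    exact isHomogeneous_formMonomial ((bitDegreeLE_standardBits.le hp).trans (by omega))
  let T := ((I.restrictScalars k).submoduleOf (homogeneousSubmodule (Fin 3) k d)).mkQ ∘ₗ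
    Submodule.inclusion hle
  -- Injectivity is independence modulo the fat points, surjectivity is spanning modulo the nonics.
  have hT : Function.Bijective T := by
    constructor
    · rw [← LinearMap.ker_eq_bot, LinearMap.ker_eq_bot']
      intro F hF
      have hF' : (F : MvPolynomial (Fin 3) k) ∈ I := by
        rwa [LinearMap.comp_apply, Submodule.mkQ_apply, Submodule.Quotient.mk_eq_zero] at hF
      exact Subtype.ext (eq_zero_of_mem_monomialSpan ha hb F.2
        (dehomogenize_mem_of_mem_baseIdeal hF'))
    · intro F
      obtain ⟨F, rfl⟩ := Submodule.mkQ_surjective _ F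
      obtain ⟨S, hS, G, hG, h⟩ := Submodule.mem_sup.mp (mem_monomialSpan hI hd F.2)
      refine ⟨⟨S, hS⟩, ?_⟩
      rw [LinearMap.comp_apply, ← sub_eq_zero, ← map_sub, Submodule.mkQ_apply,
        Submodule.Quotient.mk_eq_zero, Submodule.submoduleOf, Submodule.mem_comap]
      have : (S : MvPolynomial (Fin 3) k) - F = -G := by rw [← h]; ring
      change S - (F : MvPolynomial (Fin 3) k) ∈ I
      rw [this]
      exact neg_mem hG
  rw [hilbertFunction, ← (LinearEquiv.ofBijective T hT).finrank_eq, monomialSpan_standardBits,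
    finrank_span_eq_card, card_standardBits]
  rw [Fintype.linearIndependent_iff]
  intro c hc
  exact congrFun (sum_smul_formMonomial_eq_zero (d := d) ha hb (by rw [hc]; simp))

/-- An element of the ideal of the fat points has zero standard part, so in the chart it lies in the
ideal of the nonics and vanishes at each of their common zeros. -/
theorem assignedIdeal_le_ker_eval (ha : bitSum (a ^ ·) 27987 = 0) (hb : bitSum (b ^ ·) 47 = 0)
    {q : Fin 2 → K} (hq : ∀ n ∈ nonics, eval ![q 0, q 1, 1] (form K 9 n) = 0) :
    assignedIdeal a b ≤ RingHom.ker (eval q) := by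
  intro f hf
  obtain ⟨S, hS, G, hG, rfl⟩ := Submodule.mem_sup.mp
    (mem_span_affineMonomial (form_nonic_mem_span K) f)
  have hS' := sub_mem hf (dehomogenize_mem_of_mem_span ha hb hG)
  rw [add_sub_cancel_right] at hS'
  obtain ⟨c, rfl⟩ := (Submodule.mem_span_range_iff_exists_fun K).mp hS
  have hle : (Ideal.span (form K 9 '' {n | n ∈ nonics})).map (dehomogenize K).toRingHom ≤
      RingHom.ker (eval q) := by
    rw [Ideal.map_le_iff_le_comap, Ideal.span_le]
    rintro _ ⟨n, hn, rfl⟩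
    change eval q (dehomogenize K _) = 0
    rw [eval_dehomogenize, hq n hn]
  simpa [eq_zero_of_sum_mem_assignedIdeal ha hb hS'] using hle hG

theorem apply_two_ne_zero {v : Fin 3 → K} (hv : v ≠ 0)
    (h : ∀ n ∈ nonics, eval v (form K 9 n) = 0) : v 2 ≠ 0 := by
  intro h2
  have hI : Ideal.span (form K 9 '' {n | n ∈ nonics}) ≤ RingHom.ker (eval v) :=
    Ideal.span_le.mpr (by rintro _ ⟨n, hn, rfl⟩; exact h n hn)
  -- Modulo the nonics this monomial is a multiple of z, and z vanishes at `v`.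
  have key {i j : ℕ} (hij : i + j = 12) : v 0 ^ i * v 1 ^ j = 0 := by
    obtain ⟨F, G, -, hG, hFG⟩ := exists_X_two_mul_add_mem (form_nonic_mem_span K) le_rfl hij
    have := congrArg (eval v) hFG
    rw [map_add, RingHom.mem_ker.mp (hI hG)] at this
    simpa [h2] using this
  have h0 : v 0 = 0 := by simpa using key (i := 12) (j := 0) rfl
  have h1 : v 1 = 0 := by simpa using key (i := 0) (j := 12) rfl
  refine hv (funext fun i => ?_)
  fin_cases i
  · exact h0
  · exact h1
  · exact h2

theorem basePoints_linearSystem_nine (ha : bitSum (a ^ ·) 27987 = 0)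
    (hb : bitSum (b ^ ·) 47 = 0) :
    basePoints K (linearSystem k 9 (assignedPoint a b) assignedMult) =
      Set.range (assignedPoint a b) := by
  ext p
  constructor
  · intro hp
    have hform : ∀ v ∈ p.submodule, ∀ n ∈ nonics, eval v (form K 9 n) = 0 := fun v hv n hn => by
      rw [← aeval_eq_eval_form (k := k)]
      exact hp _ (form_nonic_mem_linearSystem k ha hb hn) v hv
    induction p using Projectivization.ind with
    | h v hv =>
      rw [Projectivization.submodule_mk] at hform
      have h2 := apply_two_ne_zero hv (hform v (Submodule.mem_span_singleton_self v))
      have hv' : (v 2)⁻¹ • v = ![v 0 / v 2, v 1 / v 2, 1] := by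
        funext i
        fin_cases i <;> simp [h2, div_eq_inv_mul]
      obtain ⟨i, hi⟩ := mem_range_of_fatIdeal_le (m := assignedMult)
        (by rintro (i | i | i) <;> simp [assignedMult])
        (assignedIdeal_le_ker_eval ha hb (q := ![v 0 / v 2, v 1 / v 2])
          (by simpa [← hv'] using hform ((v 2)⁻¹ • v) (Submodule.mem_span_singleton.mpr ⟨_, rfl⟩)))
      refine ⟨i, ?_⟩
      rw [assignedPoint_eq, hi]
      exact (Projectivization.mk_eq_mk_iff' K _ _ _ _).mpr ⟨(v 2)⁻¹, hv'⟩
  · rintro ⟨i, rfl⟩ F hF v hv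
    have h1 : map (algebraMap k K) F ∈ pointIdeal (assignedPoint a b i) :=
      Ideal.pow_le_self (by rcases i with i | i | i <;> simp [assignedMult]) (hF.2 i)
    have := aeval_eq_zero_of_mem_pointIdeal h1 v hv
    rwa [aeval_map_algebraMap] at this

end System

end PlaneSystem

end

theorem proposition2p2 {k K : Type*} [Field k] [Field K] [IsAlgClosed K] [CharP K 2]
    [Algebra k K] (a b : K)
    (ha : a ^ 14 + a ^ 13 + a ^ 11 + a ^ 10 + a ^ 8 + a ^ 6 + a ^ 4 + a + 1 = 0)
    (hb : b ^ 5 + b ^ 3 + b ^ 2 + b + 1 = 0) :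
    -- the twenty points are distinct
    Function.Injective (PlaneSystem.assignedPoint a b) ∧
    -- the system of nonics has exactly five independent sections
    Module.finrank k (PlaneSystem.linearSystem k 9
      (PlaneSystem.assignedPoint a b) PlaneSystem.assignedMult) = 5 ∧
    -- its geometric base points are exactly the assigned ones
    PlaneSystem.basePoints K (PlaneSystem.linearSystem k 9
      (PlaneSystem.assignedPoint a b) PlaneSystem.assignedMult) =
        Set.range (PlaneSystem.assignedPoint a b) ∧
    -- its base scheme has degree 53
    PlaneSystem.HasDegree (PlaneSystem.baseIdeal (PlaneSystem.linearSystem k 9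
      (PlaneSystem.assignedPoint a b) PlaneSystem.assignedMult)) 53 ∧
    -- its base scheme is the union of the assigned fat points: in all large degrees, every form
    -- with the assigned multiplicities lies in the ideal generated by the system
    ∀ᶠ d in Filter.atTop, ∀ F ∈ PlaneSystem.linearSystem k d
      (PlaneSystem.assignedPoint a b) PlaneSystem.assignedMult,
        F ∈ PlaneSystem.baseIdeal (PlaneSystem.linearSystem k 9
          (PlaneSystem.assignedPoint a b) PlaneSystem.assignedMult) := by
  have ha' := PlaneSystem.bitSum_pow_eq_zero_fourteen ha
  have hb' := PlaneSystem.bitSum_pow_eq_zero_five hb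
  exact ⟨PlaneSystem.assignedPoint_injective ha' hb',
    PlaneSystem.finrank_linearSystem_nine ha' hb',
    PlaneSystem.basePoints_linearSystem_nine ha' hb',
    Filter.eventually_atTop.mpr ⟨12, fun _ hd => PlaneSystem.hilbertFunction_baseIdeal ha' hb' hd⟩,
    Filter.eventually_atTop.mpr ⟨12, fun _ hd _ hF =>
      PlaneSystem.linearSystem_le_baseIdeal ha' hb' hd hF⟩⟩
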